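/- Let $\Gamma=\mathrm{SL}_2(\mathbb{Z})$, let $S_k(\Gamma)$ be the space of cusp forms of weight $k$ for $\Gamma$, and for $n\ge 1$ let $T_n$ be the Hecke operator on $S_k(\Gamma)$, which sends $\sum_{m\ge1} b(m)q^m$ to $\sum_{m\ge1}\bigl(\sum_{d\mid\gcd(m,n)} d^{k-1}b(mn/d^2)\bigr)q^m$, where $q=e^{2\pi i\tau}$. A normalized Hecke eigenform is a form $f\in S_k(\Gamma)$ that is an eigenform of $T_p$ for every prime $p$ and whose coefficient of $q$ equals $1$. Let $\Delta(\tau)=\eta(\tau)^{24}=q\prod_{m\ge1}(1-q^m)^{24}$ and let $a_{48}(n)$, $n\ge 0$, be defined by $\Delta(\tau)^2=\eta(\tau)^{48}=q^2\sum_{n\ge0}a_{48}(n)q^n$. (1) $\dim_{\mathbb{C}} S_{24}(\Gamma)=2$, and $S_{24}(\Gamma)$ contains exactly two normalized Hecke eigenforms $f\ne g$; there is a constant $\kappa\neq0$ with $\Delta^2=(f-g)/\kappa$. (2) For every integer $n\ge1$, the $n$-th Fourier coefficient of $\Delta^2$ (the coefficient of $q^n$) is non-zero if and only if the eigenvalues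 of $T_n$ on $S_{24}(\Gamma)$, counted with multiplicity as roots of the characteristic polynomial, are distinct; equivalently, it vanishes exactly when $T_n$ has a repeated eigenvalue. (3) Suppose that Maeda's conjecture holds in weight $24$, that is, for every $n>1$ the characteristic polynomial of $T_n$ on $S_{24}(\Gamma)$ has rational coefficients, is irreducible over $\mathbb{Q}$, and the Galois group of its splitting field over $\mathbb{Q}$ is the full symmetric group on $d=\dim S_{24}(\Gamma)$ letters. Then $a_{48}(n)\neq0$ for all integers $n\ge0$. -/

import Mathlib

open UpperHalfPlane Polynomial
open scoped MatrixGroups ModularForm Manifold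

noncomputable section

namespace Hecke

/-- An integral `2 × 2` matrix of determinant `n ≥ 1`, as an element of `GL₂(ℝ)`. -/
def toGL {n : ℕ+} (A : FixedDetMatrix (Fin 2) ℤ (n : ℤ)) : GL (Fin 2) ℝ :=
  Matrix.GeneralLinearGroup.mkOfDetNeZero (A.1.map (Int.cast : ℤ → ℝ)) (by
    have h : (A.1.map (Int.cast : ℤ → ℝ)).det = ((A.1.det : ℤ) : ℝ) :=
      ((Int.castRingHom ℝ).map_det A.1).symm
    rw [h, A.2]
    exact_mod_cast n.pos.ne')

lemma toGL_apply {n : ℕ+} (A : FixedDetMatrix (Fin 2) ℤ (n : ℤ)) (i j : Fin 2) :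
    toGL A i j = (A.1 i j : ℝ) := rfl

lemma toGL_det {n : ℕ+} (A : FixedDetMatrix (Fin 2) ℤ (n : ℤ)) :
    (toGL A).det.val = (n : ℝ) := by
  have h : (A.1.map (Int.cast : ℤ → ℝ)).det = ((A.1.det : ℤ) : ℝ) :=
    ((Int.castRingHom ℝ).map_det A.1).symm
  rw [A.2] at h
  change (A.1.map (Int.cast : ℤ → ℝ)).det = (n : ℝ)
  simpa using h

lemma toGL_smul {n : ℕ+} (γ : SL(2, ℤ)) (A : FixedDetMatrix (Fin 2) ℤ (n : ℤ)) :
    toGL (γ • A) = (γ : GL (Fin 2) ℝ) * toGL A := by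
  ext i j
  simp [toGL_apply, FixedDetMatrices.smul_coe, Matrix.mul_apply]

/-- Right multiplication of a matrix of determinant `n` by `γ ∈ SL₂(ℤ)`. -/
def mulRight {n : ℕ+} (A : FixedDetMatrix (Fin 2) ℤ (n : ℤ)) (γ : SL(2, ℤ)) :
    FixedDetMatrix (Fin 2) ℤ (n : ℤ) :=
  ⟨A.1 * γ.1, by rw [Matrix.det_mul, A.2, γ.2, mul_one]⟩

lemma toGL_mulRight {n : ℕ+} (A : FixedDetMatrix (Fin 2) ℤ (n : ℤ)) (γ : SL(2, ℤ)) :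
    toGL (mulRight A γ) = toGL A * (γ : GL (Fin 2) ℝ) := by
  ext i j
  have h : (toGL A * (γ : GL (Fin 2) ℝ)) i j = ∑ l, (A.1 i l : ℝ) * (γ.1 l j : ℝ) := rfl
  have h' : (mulRight A γ).1 i j = ∑ l, A.1 i l * γ.1 l j := rfl
  rw [h, toGL_apply, h']
  push_cast
  rfl

lemma exists_reduce_eq {m : ℤ} (A : FixedDetMatrix (Fin 2) ℤ m) :
    ∃ γ : SL(2, ℤ), FixedDetMatrices.reduce A = γ • A := by
  induction A using FixedDetMatrices.reduce_rec with
  | base A h =>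
    by_cases h1 : 0 < A.1 0 0
    · exact ⟨_, FixedDetMatrices.reduce_of_pos h h1⟩
    · refine ⟨ModularGroup.T ^ (-(-A.1 0 1 / -A.1 1 1)) * ModularGroup.S * ModularGroup.S,
        (FixedDetMatrices.reduce_of_not_pos h h1).trans ?_⟩
      rw [mul_smul, mul_smul]
  | step A h ih =>
    obtain ⟨γ, hγ⟩ := ih
    rw [FixedDetMatrices.reduce_reduceStep h] at hγ
    refine ⟨γ * (ModularGroup.S * ModularGroup.T ^ (-(A.1 0 0 / A.1 1 0))), hγ.trans ?_⟩
    rw [mul_smul, mul_smul, FixedDetMatrices.reduceStep]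

lemma reps_unique {n : ℕ+} {A B : FixedDetMatrix (Fin 2) ℤ (n : ℤ)}
    (hA : A ∈ FixedDetMatrices.reps (n : ℤ)) (hB : B ∈ FixedDetMatrices.reps (n : ℤ))
    (γ : SL(2, ℤ)) (h : B = γ • A) : A = B := by
  obtain ⟨a10, a00, a01, a11⟩ := hA
  obtain ⟨b10, b00, b01, b11⟩ := hB
  have hn : (0 : ℤ) < n := by exact_mod_cast n.pos
  have dA := A.2
  have dB := B.2
  have dγ := γ.2
  rw [Matrix.det_fin_two] at dA dB dγ
  have e : ∀ i j, B.1 i j = γ.1 i 0 * A.1 0 j + γ.1 i 1 * A.1 1 j := by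
    intro i j
    rw [h, FixedDetMatrices.smul_coe, Matrix.mul_apply, Fin.sum_univ_two]
  have e00 := e 0 0
  have e01 := e 0 1
  have e10 := e 1 0
  have e11 := e 1 1
  rw [a10] at e00 e10 dA
  rw [b10] at e10 dB
  have g10 : γ.1 1 0 = 0 := by
    have : γ.1 1 0 * A.1 0 0 = 0 := by linarith
    rcases mul_eq_zero.mp this with h | h
    · exact h
    · omega
  rw [g10] at dγ e11
  have ha11 : 0 < A.1 1 1 := by
    by_contra hc
    have := mul_nonpos_of_nonneg_of_nonpos a00.le (not_lt.mp hc)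
    linarith
  have hb11 : 0 < B.1 1 1 := by
    by_contra hc
    have := mul_nonpos_of_nonneg_of_nonpos b00.le (not_lt.mp hc)
    linarith
  have g00 : 0 < γ.1 0 0 := by
    by_contra hc
    have := mul_nonpos_of_nonpos_of_nonneg (not_lt.mp hc) a00.le
    linarith
  have g1 : γ.1 0 0 = 1 ∧ γ.1 1 1 = 1 := by
    have : γ.1 0 0 * γ.1 1 1 = 1 := by linarith
    rcases Int.mul_eq_one_iff_eq_one_or_neg_one.mp this with h | h
    · exact h
    · omega
  rw [g1.1] at e00 e01
  rw [g1.2] at e11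
  have e11' : B.1 1 1 = A.1 1 1 := by linarith
  rw [e11', abs_of_nonneg b01, abs_of_pos ha11] at b11
  rw [abs_of_nonneg a01, abs_of_pos ha11] at a11
  have g01 : γ.1 0 1 = 0 := by
    by_contra hc
    rcases lt_or_gt_of_ne hc with hc | hc
    · nlinarith
    · nlinarith
  rw [g01] at e00 e01
  ext i j
  fin_cases i <;> fin_cases j <;> simp <;> linarith

/-- The function `∑ f ∣[k] A`, summed over the representatives `A = (a b; 0 d)`, `a d = n`, `a > 0`,
`0 ≤ b < d`, of `SL₂(ℤ) \ {integral matrices of determinant n}`. Explicitly it is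
`τ ↦ n ^ (k - 1) * ∑ d ^ (-k) * f ((a τ + b) / d)`. -/
def heckeFun (k : ℤ) (n : ℕ+) (f : ℍ → ℂ) : ℍ → ℂ :=
  ∑ A : FixedDetMatrices.reps (n : ℤ), f ∣[k] (toGL A.1)

lemma heckeFun_slash {k : ℤ} {n : ℕ+} (f : CuspForm 𝒮ℒ k) (γ : SL(2, ℤ)) :
    heckeFun k n f ∣[k] (γ : GL (Fin 2) ℝ) = heckeFun k n f := by
  have hn : (n : ℤ) ≠ 0 := by exact_mod_cast n.pos.ne'
  have hinv : ∀ δ : SL(2, ℤ), (f : ℍ → ℂ) ∣[k] (δ : GL (Fin 2) ℝ) = f := fun δ =>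
    SlashInvariantFormClass.slash_action_eq f _ ⟨δ, rfl⟩
  let φ : FixedDetMatrices.reps (n : ℤ) → FixedDetMatrices.reps (n : ℤ) := fun A =>
    ⟨FixedDetMatrices.reduce (mulRight A.1 γ), FixedDetMatrices.reduce_mem_reps hn _⟩
  have hφ : Function.Injective φ := by
    intro A B hAB
    have hAB' : FixedDetMatrices.reduce (mulRight A.1 γ) =
      FixedDetMatrices.reduce (mulRight B.1 γ) := congrArg Subtype.val hAB
    obtain ⟨δ, hδ⟩ := exists_reduce_eq (mulRight A.1 γ)
    obtain ⟨ε, hε⟩ := exists_reduce_eq (mulRight B.1 γ)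
    rw [hδ, hε] at hAB'
    have h1 : mulRight B.1 γ = (ε⁻¹ * δ) • mulRight A.1 γ := by
      rw [mul_smul, hAB', inv_smul_smul]
    have h2 : B.1 = (ε⁻¹ * δ) • A.1 := by
      apply FixedDetMatrices.ext'
      have h3 := congrArg (fun M => M.1 * (γ⁻¹ : SL(2, ℤ)).1) h1
      have h4 : γ.1 * (γ⁻¹ : SL(2, ℤ)).1 = 1 := by
        rw [← Matrix.SpecialLinearGroup.coe_mul, mul_inv_cancel, Matrix.SpecialLinearGroup.coe_one]
      simp only [FixedDetMatrices.smul_coe] at h3 ⊢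
      simpa only [mulRight, Matrix.mul_assoc, h4, Matrix.mul_one] using h3
    exact Subtype.ext (reps_unique A.2 B.2 _ h2)
  have hb : Function.Bijective φ := Finite.injective_iff_bijective.mp hφ
  rw [heckeFun, SlashAction.sum_slash]
  refine Fintype.sum_bijective φ hb _ _ fun A => ?_
  obtain ⟨δ, hδ⟩ := exists_reduce_eq (mulRight A.1 γ)
  rw [← SlashAction.slash_mul, ← toGL_mulRight]
  change _ = (f : ℍ → ℂ) ∣[k] (toGL (FixedDetMatrices.reduce (mulRight A.1 γ)))
  rw [hδ, toGL_smul, SlashAction.slash_mul, hinv]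

lemma heckeFun_zero_at_infty {k : ℤ} {n : ℕ+} (f : CuspForm 𝒮ℒ k) :
    IsZeroAtImInfty (heckeFun k n f) := by
  have h : ∀ A ∈ (Finset.univ : Finset (FixedDetMatrices.reps (n : ℤ))),
      Filter.Tendsto ((f : ℍ → ℂ) ∣[k] (toGL A.1)) atImInfty (nhds 0) := fun A _ =>
    IsZeroAtImInfty.slash k (by rw [toGL_apply, A.2.1, Int.cast_zero])
      (CuspFormClass.zero_at_infty f)
  have := tendsto_finsetSum _ h
  rw [Finset.sum_const_zero] at this
  exact this.congr fun τ => by rw [heckeFun, Finset.sum_apply]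

/-- The Hecke operator `T_n` (`n ≥ 1`) on the space `S_k(SL₂(ℤ))` of cusp forms. -/
def heckeOperator (k : ℤ) (n : ℕ+) : CuspForm 𝒮ℒ k →ₗ[ℂ] CuspForm 𝒮ℒ k where
  toFun f :=
    { toFun := heckeFun k n f
      slash_action_eq' := by
        rintro _ ⟨γ, rfl⟩
        exact heckeFun_slash f γ
      holo' := by
        change MDiff (heckeFun k n f)
        exact .sum fun A _ => (CuspFormClass.holo f).slash k _
      zero_at_cusps' := by
        intro c hc
        rw [Subgroup.IsArithmetic.isCusp_iff_isCusp_SL2Z] at hc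
        rw [OnePoint.isZeroAt_iff_forall_SL2Z hc]
        intro γ _
        change IsZeroAtImInfty (heckeFun k n f ∣[k] (γ : GL (Fin 2) ℝ))
        rw [heckeFun_slash]
        exact heckeFun_zero_at_infty f }
  map_add' f g := by
    apply DFunLike.coe_injective
    change heckeFun k n (⇑f + ⇑g) = heckeFun k n f + heckeFun k n g
    simp [heckeFun, Finset.sum_add_distrib]
  map_smul' c f := by
    apply DFunLike.coe_injective
    change heckeFun k n (c • ⇑f) = c • heckeFun k n f
    have hσ : ∀ A : FixedDetMatrix (Fin 2) ℤ (n : ℤ), σ (toGL A) c = c := fun A => by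
      have : (0 : ℝ) < (toGL A).det.val := by
        rw [toGL_det]; exact_mod_cast n.pos
      rw [σ, if_pos this]; rfl
    simp only [heckeFun, ModularForm.smul_slash, hσ, Finset.smul_sum]

lemma coe_heckeOperator (k : ℤ) (n : ℕ+) (f : CuspForm 𝒮ℒ k) :
    (heckeOperator k n f : ℍ → ℂ) = heckeFun k n f := rfl


lemma hasSum_average {c : ℕ → ℂ} {f : ℍ → ℂ}
    (hf : ∀ τ : ℍ, HasSum (fun j ↦ c j * Function.Periodic.qParam 1 τ ^ j) (f τ))
    {a d : ℕ} (ha : 0 < a) (hd : 0 < d) (τ : ℍ) (p : ℕ → ℍ)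
    (hp : ∀ b ∈ Finset.range d, (p b : ℂ) = (a * τ + b) / d) :
    HasSum (fun m ↦ (if a ∣ m then d * c (d * (m / a)) else 0) * Function.Periodic.qParam 1 τ ^ m)
      (∑ b ∈ Finset.range d, f (p b)) := by
  have hd' : (d : ℂ) ≠ 0 := by exact_mod_cast hd.ne'
  have h1 := hasSum_sum fun b (_ : b ∈ Finset.range d) => hf (p b)
  have hζ := Complex.isPrimitiveRoot_exp d hd.ne'
  set ζ := Complex.exp (2 * Real.pi * Complex.I / d) with hζd
  have h2 : ∀ j : ℕ, ∑ b ∈ Finset.range d, c j * Function.Periodic.qParam 1 (p b) ^ j =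
      c j * Complex.exp (2 * Real.pi * Complex.I * (a * τ) / d) ^ j *
        ∑ b ∈ Finset.range d, (ζ ^ j) ^ b := by
    intro j
    rw [Finset.mul_sum]
    refine Finset.sum_congr rfl fun b hb => ?_
    rw [hp b hb, mul_assoc]
    congr 1
    rw [hζd, Function.Periodic.qParam, ← Complex.exp_nat_mul, ← Complex.exp_nat_mul,
      ← Complex.exp_nat_mul, ← Complex.exp_nat_mul, ← Complex.exp_add]
    congr 1
    push_cast
    field_simp
  have h3 : ∀ j : ℕ, ¬ d ∣ j → ∑ b ∈ Finset.range d, (ζ ^ j) ^ b = 0 := by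
    intro j hj
    have hne : ζ ^ j ≠ 1 := fun h => hj ((hζ.pow_eq_one_iff_dvd j).mp h)
    rw [geom_sum_eq hne, ← pow_mul, mul_comm, pow_mul, hζ.pow_eq_one, one_pow, sub_self, zero_div]
  have h4 : ∀ l : ℕ, ∑ b ∈ Finset.range d, c (d * l) * Function.Periodic.qParam 1 (p b) ^ (d * l) =
      d * c (d * l) * Function.Periodic.qParam 1 τ ^ (a * l) := by
    intro l
    have e1 : ζ ^ (d * l) = 1 := by rw [pow_mul, hζ.pow_eq_one, one_pow]
    have e2 : Complex.exp (2 * Real.pi * Complex.I * (a * τ) / d) ^ (d * l) =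
        Function.Periodic.qParam 1 τ ^ (a * l) := by
      rw [Function.Periodic.qParam, ← Complex.exp_nat_mul, ← Complex.exp_nat_mul]
      congr 1
      push_cast
      field_simp
    rw [h2, e1, e2]
    simp
    ring
  have inj1 : Function.Injective fun l : ℕ => d * l := fun x y h => Nat.eq_of_mul_eq_mul_left hd h
  have inj2 : Function.Injective fun l : ℕ => a * l := fun x y h => Nat.eq_of_mul_eq_mul_left ha h
  have h5 := (inj1.hasSum_iff (fun j hj => by
    rw [h2, h3 j (fun ⟨l, hl⟩ => hj ⟨l, hl.symm⟩), mul_zero])).mpr h1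
  refine (inj2.hasSum_iff (fun m hm => ?_)).mp ?_
  · rw [if_neg (fun ⟨l, hl⟩ => hm ⟨l, hl.symm⟩), zero_mul]
  · refine h5.congr_fun ?_
    intro l
    simp only [Function.comp_apply]
    rw [h4, if_pos (dvd_mul_right a l), Nat.mul_div_cancel_left l ha]

lemma reps_facts {n : ℕ+} (A : FixedDetMatrices.reps (n : ℤ)) :
    A.1.1 0 0 * A.1.1 1 1 = n ∧ 0 < A.1.1 1 1 ∧ A.1.1 0 1 < A.1.1 1 1 := by
  obtain ⟨A, a10, a00, a01, a11⟩ := A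
  have hn : (0 : ℤ) < n := by exact_mod_cast n.pos
  have dA := A.2
  rw [Matrix.det_fin_two, a10, mul_zero, sub_zero] at dA
  have h : 0 < A.1 1 1 := pos_of_mul_pos_right (by rw [dA]; exact hn) a00.le
  rw [abs_of_nonneg a01, abs_of_pos h] at a11
  exact ⟨dA, h, a11⟩

lemma sum_reps {n : ℕ+} (F : ℤ → ℤ → ℤ → ℂ) :
    ∑ A : FixedDetMatrices.reps (n : ℤ), F (A.1.1 0 0) (A.1.1 0 1) (A.1.1 1 1) =
      ∑ d ∈ (n : ℕ).divisors, ∑ b ∈ Finset.range d, F ((n : ℕ) / d : ℕ) b d := by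
  rw [Finset.sum_sigma']
  refine Finset.sum_bij
    (fun A _ => (⟨(A.1.1 1 1).natAbs, (A.1.1 0 1).natAbs⟩ : (_ : ℕ) × ℕ)) ?_ ?_ ?_ ?_
  · intro A _
    obtain ⟨h1, h2, h3⟩ := reps_facts A
    have h4 : 0 ≤ A.1.1 0 1 := A.2.2.2.1
    simp only [Finset.mem_sigma, Nat.mem_divisors, Finset.mem_range]
    refine ⟨⟨?_, n.pos.ne'⟩, by omega⟩
    rw [← Int.natCast_dvd_natCast, Int.natAbs_of_nonneg h2.le]
    exact ⟨_, by rw [mul_comm]; exact h1.symm⟩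
  · intro A _ B _ h
    obtain ⟨hA1, hA2, hA3⟩ := reps_facts A
    obtain ⟨hB1, hB2, hB3⟩ := reps_facts B
    have hA4 : 0 ≤ A.1.1 0 1 := A.2.2.2.1
    have hB4 : 0 ≤ B.1.1 0 1 := B.2.2.2.1
    simp only [Sigma.mk.injEq, heq_eq_eq] at h
    have e11 : A.1.1 1 1 = B.1.1 1 1 := by omega
    have e01 : A.1.1 0 1 = B.1.1 0 1 := by omega
    have e10 : A.1.1 1 0 = B.1.1 1 0 := A.2.1.trans B.2.1.symm
    have e00 : A.1.1 0 0 = B.1.1 0 0 := by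
      have h5 := hA1.trans hB1.symm
      rw [e11] at h5
      exact mul_right_cancel₀ hB2.ne' h5
    apply Subtype.ext
    ext i j
    fin_cases i <;> fin_cases j
    exacts [e00, e01, e10, e11]
  · rintro ⟨d, b⟩ h
    simp only [Finset.mem_sigma, Nat.mem_divisors, Finset.mem_range] at h
    obtain ⟨⟨hd, -⟩, hb⟩ := h
    have hmul : (((n : ℕ) / d : ℕ) : ℤ) * d = n := by exact_mod_cast Nat.div_mul_cancel hd
    have hpos : 0 < (n : ℕ) / d := Nat.div_pos (Nat.le_of_dvd n.pos hd) (by omega)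
    refine ⟨⟨⟨!![(((n : ℕ) / d : ℕ) : ℤ), b; 0, d], ?_⟩, ?_⟩, Finset.mem_univ _, ?_⟩
    · rw [Matrix.det_fin_two_of, mul_zero, sub_zero, hmul]
    · refine ⟨rfl, ?_, ?_, ?_⟩
      · change (0 : ℤ) < (((n : ℕ) / d : ℕ) : ℤ)
        exact_mod_cast hpos
      · exact Int.natCast_nonneg b
      · change |(b : ℤ)| < |(d : ℤ)|
        simpa using hb
    · simp
  · intro A _
    obtain ⟨h1, h2, h3⟩ := reps_facts A
    have h4 : 0 ≤ A.1.1 0 1 := A.2.2.2.1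
    have h5 : (((n : ℕ) / (A.1.1 1 1).natAbs : ℕ) : ℤ) = A.1.1 0 0 := by
      push_cast
      rw [abs_of_pos h2]
      exact Int.ediv_eq_of_eq_mul_left h2.ne' h1.symm
    rw [h5, Int.natAbs_of_nonneg h2.le, Int.natAbs_of_nonneg h4]

/-- The point `(a τ + b) / d` of the upper half-plane (for `a, d > 0`). -/
def affinePoint (a b d : ℤ) (τ : ℍ) : ℍ := ofComplex ((a * τ + b) / d)

lemma heckeFun_apply (k : ℤ) (n : ℕ+) (f : ℍ → ℂ) (τ : ℍ) :
    heckeFun k n f τ = ∑ d ∈ (n : ℕ).divisors, ∑ b ∈ Finset.range d,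
      (n : ℂ) ^ (k - 1) * (d : ℂ) ^ (-k) * f (affinePoint ((n : ℕ) / d : ℕ) b d τ) := by
  have h := sum_reps (n := n) fun a b d =>
    (n : ℂ) ^ (k - 1) * (d : ℂ) ^ (-k) * f (affinePoint a b d τ)
  simp only [Int.cast_natCast] at h
  rw [← h, heckeFun, Finset.sum_apply]
  refine Finset.sum_congr rfl fun A _ => ?_
  have hdet : (0 : ℝ) < (toGL A.1).det.val := by
    rw [toGL_det]; exact_mod_cast n.pos
  have hden : denom (toGL A.1) τ = (A.1.1 1 1 : ℂ) := by
    rw [denom, toGL_apply, toGL_apply, A.2.1]; simp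
  have hpt : affinePoint (A.1.1 0 0) (A.1.1 0 1) (A.1.1 1 1) τ = toGL A.1 • τ := by
    have : ((toGL A.1 • τ : ℍ) : ℂ) =
        ((A.1.1 0 0 : ℂ) * τ + (A.1.1 0 1 : ℂ)) / (A.1.1 1 1 : ℂ) := by
      rw [coe_smul_of_det_pos hdet, hden, num, toGL_apply, toGL_apply]
      simp
    rw [affinePoint, ← this, ofComplex_apply]
  have hσ : σ (toGL A.1) = ContinuousAlgEquiv.refl ℝ ℂ := by rw [σ, if_pos hdet]
  rw [ModularForm.slash_apply, hσ, hden, hpt, toGL_det, abs_of_pos (by exact_mod_cast n.pos)]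
  simp only [ContinuousAlgEquiv.refl_apply, Complex.ofReal_natCast]
  ring

/-- The effect of `T_n` on Fourier coefficients: if `f = ∑ b(m) q ^ m`, then the `m`-th coefficient
of `T_n f` is `∑ d ^ (k - 1) * b(m n / d ^ 2)`, the sum being over the `d ∣ gcd(m, n)`. -/
theorem coeff_heckeOperator (k : ℤ) (n : ℕ+) (f : CuspForm 𝒮ℒ k) (m : ℕ) :
    (qExpansion 1 (heckeOperator k n f)).coeff m =
      ∑ d ∈ (Nat.gcd m n).divisors,
        (d : ℂ) ^ (k - 1) * (qExpansion 1 f).coeff (m * n / d ^ 2) := by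
  have hf := fun τ => ModularForm.hasSum_qExpansion f one_pos one_mem_strictPeriods_SL τ
  have hn : (n : ℕ) ≠ 0 := n.pos.ne'
  set c := fun j => (qExpansion 1 f).coeff j with hc
  have key : ∀ τ : ℍ, HasSum (fun m ↦ (∑ d ∈ (n : ℕ).divisors, (n : ℂ) ^ (k - 1) * (d : ℂ) ^ (-k) *
      (if (n : ℕ) / d ∣ m then (d : ℂ) * c (d * (m / ((n : ℕ) / d))) else 0)) •
        Function.Periodic.qParam 1 τ ^ m) (heckeOperator k n f τ) := by
    intro τ
    rw [coe_heckeOperator, heckeFun_apply]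
    have := hasSum_sum fun d (hd : d ∈ (n : ℕ).divisors) =>
      (hasSum_average hf (a := (n : ℕ) / d) (d := d)
        (Nat.div_pos (Nat.divisor_le hd) (Nat.pos_of_mem_divisors hd))
        (Nat.pos_of_mem_divisors hd) τ (fun b => affinePoint ((n : ℕ) / d : ℕ) b d τ) (by
          intro b hb
          have hd0 : (0 : ℝ) < d := by exact_mod_cast Nat.pos_of_mem_divisors hd
          have ha0 : (0 : ℝ) < ((n : ℕ) / d : ℕ) := by
            exact_mod_cast Nat.div_pos (Nat.divisor_le hd) (Nat.pos_of_mem_divisors hd)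
          rw [affinePoint, ofComplex_apply_of_im_pos]
          · simp only [Int.cast_natCast]
          · simp only [Int.cast_natCast]
            rw [Complex.div_natCast_im, Complex.add_im, Complex.natCast_im, add_zero,
              ← Complex.ofReal_natCast, Complex.im_ofReal_mul]
            exact div_pos (mul_pos ha0 τ.im_pos) hd0)).mul_left ((n : ℂ) ^ (k - 1) * (d : ℂ) ^ (-k))
    simp only [Finset.mul_sum] at this
    refine this.congr_fun ?_
    intro m
    rw [smul_eq_mul, Finset.sum_mul]
    refine Finset.sum_congr rfl fun d _ => by ring
  rw [← ModularFormClass.qExpansion_coeff_unique one_pos one_mem_strictPeriods_SL key m]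
  rw [← Nat.sum_div_divisors]
  have hdiv : (Nat.gcd m n).divisors = (n : ℕ).divisors.filter (· ∣ m) := by
    ext d
    simp only [Nat.mem_divisors, Finset.mem_filter, Nat.dvd_gcd_iff]
    have : Nat.gcd m n ≠ 0 := fun h => hn (Nat.eq_zero_of_gcd_eq_zero_right h)
    tauto
  rw [hdiv, Finset.sum_filter]
  refine Finset.sum_congr rfl fun a ha => ?_
  have hdn : a ∣ n := Nat.dvd_of_mem_divisors ha
  have ha0 : 0 < a := Nat.pos_of_mem_divisors ha
  rw [Nat.div_div_self hdn hn]
  split_ifs with h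
  · obtain ⟨l, rfl⟩ := h
    obtain ⟨d, hd⟩ := hdn
    have hd0 : (d : ℂ) ≠ 0 := by
      rintro h
      rw [Nat.cast_eq_zero] at h
      rw [hd, h, mul_zero] at hn
      exact hn rfl
    have ha0' : (a : ℂ) ≠ 0 := by exact_mod_cast ha0.ne'
    have e1 : (n : ℕ) / a = d := by rw [hd, Nat.mul_div_cancel_left _ ha0]
    have e2 : a * l * n / a ^ 2 = d * l := by
      rw [hd, show a * l * (a * d) = a ^ 2 * (d * l) by ring,
        Nat.mul_div_cancel_left _ (by positivity)]
    have e3 : ((n : ℕ) : ℂ) = a * d := by exact_mod_cast hd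
    rw [e1, e2, Nat.mul_div_cancel_left _ ha0, e3, mul_zpow, zpow_sub_one₀ hd0, zpow_neg]
    have := zpow_ne_zero k hd0
    field_simp
    rfl
  · rw [mul_zero]

instance (k : ℤ) : FiniteDimensional ℂ (CuspForm 𝒮ℒ k) :=
  FiniteDimensional.of_injective CuspForm.toModularFormₗ CuspForm.toModularFormₗ_injective

/-- The `n`-th Fourier coefficient at `∞`, i.e. the coefficient of `q ^ n`, `q = exp(2πiτ)`. -/
def fourierCoeff (f : ℍ → ℂ) (n : ℕ) : ℂ := (qExpansion 1 f).coeff n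

/-- A normalized Hecke eigenform of weight `k` and level one: an eigenform for all `T_p`, `p` prime,
whose first Fourier coefficient is `1`. -/
def IsNormalizedEigenform {k : ℤ} (f : CuspForm 𝒮ℒ k) : Prop :=
  (∀ p : ℕ+, (p : ℕ).Prime → ∃ μ : ℂ, heckeOperator k p f = μ • f) ∧ fourierCoeff f 1 = 1

/-- The eigenvalues of `T_n` on `S_k(SL₂(ℤ))`, i.e. the complex roots of its characteristic
polynomial listed with multiplicity, are pairwise distinct. -/
def HasDistinctEigenvalues (k : ℤ) (n : ℕ+) : Prop :=
  (heckeOperator k n).charpoly.roots.Nodup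

/-- Maeda's conjecture in weight `k`: for each `n > 1` the characteristic polynomial of `T_n` on
`S_k(SL₂(ℤ))` is a rational polynomial which is irreducible over `ℚ`, and the Galois group of its
splitting field is the full symmetric group on `d = dim S_k(SL₂(ℤ))` letters. -/
def MaedaConjecture (k : ℤ) : Prop :=
  ∀ n : ℕ+, 1 < n → ∃ P : ℚ[X],
    P.map (algebraMap ℚ ℂ) = (heckeOperator k n).charpoly ∧ Irreducible P ∧
      Nonempty (P.Gal ≃* Equiv.Perm (Fin (Module.finrank ℂ (CuspForm 𝒮ℒ k))))

/-- The coefficients `a₄₈(n)` in `Δ² = η ^ 48 = q ^ 2 ∑ a₄₈(n) q ^ n`. -/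
def a48 (n : ℕ) : ℂ := fourierCoeff (ModularForm.discriminant ^ 2) (n + 2)

end Hecke

end

namespace Hecke

open EisensteinSeries ModularForm

/-! A cusp form of weight below 36 is determined by its coefficients `a₁` and `a₂` (`ext_of_coeff`).
In weight 24 the forms with `a₁ = 1` therefore make up the line `F_c = ΔE₄³ + (c - 696)Δ²`, with `c
= a₂` (`formOfCoeff`). Comparing `a₂` of `T₂ F_c` and `c F_c` shows that `F_c` is an eigenform
exactly when `c` is a root of an explicit quadratic with two distinct roots `c`, `d`
(`heckeOperator_two_formOfCoeff_iff`, `exists_eigenvalues`).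

Subtracting the two eigenforms gives `F_c - F_d = (c - d)Δ²` (`formOfCoeff_sub`). They form a basis
diagonalizing every `T_n`, with eigenvalues their own `n`-th coefficients, so `(c - d) a_n(Δ²)` is
the difference of the two eigenvalues of `T_n`. Under Maeda's conjecture the characteristic
polynomial is irreducible over `ℚ`, hence separable, and this difference cannot vanish for `n > 1`.
-/

/-! ### Coefficient forms, Hecke relations and the Sturm bound. -/

/-- The `n`-th Fourier coefficient as a linear form on `S_k(SL₂(ℤ))`. -/
noncomputable def coeffₗ (k : ℤ) (n : ℕ) : CuspForm 𝒮ℒ k →ₗ[ℂ] ℂ where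
  toFun f := fourierCoeff f n
  map_add' f g := by
    simp [fourierCoeff, ModularForm.qExpansion_add one_pos one_mem_strictPeriods_SL]
  map_smul' c f := by
    simp [fourierCoeff, ModularForm.qExpansion_smul one_pos one_mem_strictPeriods_SL]

lemma coeffₗ_apply {k : ℤ} (n : ℕ) (f : CuspForm 𝒮ℒ k) : coeffₗ k n f = fourierCoeff f n := rfl

lemma coeffₗ_zero {k : ℤ} (f : CuspForm 𝒮ℒ k) : coeffₗ k 0 f = 0 :=
  CuspFormClass.qExpansion_coeff_zero f one_pos one_mem_strictPeriods_SL

/-- `a_m(T_n f) = a_n(T_m f)`. -/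
lemma coeffₗ_heckeOperator_comm {k : ℤ} (m n : ℕ+) (f : CuspForm 𝒮ℒ k) :
    coeffₗ k m (heckeOperator k n f) = coeffₗ k n (heckeOperator k m f) := by
  simp only [coeffₗ_apply, fourierCoeff, coeff_heckeOperator]
  -- The coefficient formula involves `m` and `n` only through `gcd(m, n)` and `mn`.
  rw [Nat.gcd_comm, mul_comm (m : ℕ)]

lemma coeffₗ_one_heckeOperator {k : ℤ} (n : ℕ+) (f : CuspForm 𝒮ℒ k) :
    coeffₗ k 1 (heckeOperator k n f) = coeffₗ k n f := by
  simp [coeffₗ_apply, fourierCoeff, coeff_heckeOperator]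

lemma coeffₗ_two_heckeOperator_two {k : ℤ} (f : CuspForm 𝒮ℒ k) :
    coeffₗ k 2 (heckeOperator k 2 f) = coeffₗ k 4 f + 2 ^ (k - 1) * coeffₗ k 1 f := by
  have h : (2 : ℕ).divisors = {1, 2} := by decide
  simp [coeffₗ_apply, fourierCoeff, coeff_heckeOperator, h]

/-- Cusp forms of weight less than `36` are determined by their first two coefficients. -/
lemma ext_of_coeff {k : ℤ} (hk : k < 36) {f g : CuspForm 𝒮ℒ k} (h1 : coeffₗ k 1 f = coeffₗ k 1 g)
    (h2 : coeffₗ k 2 f = coeffₗ k 2 g) : f = g := by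
  rw [← sub_eq_zero]
  apply CuspForm.toModularFormₗ_injective
  rw [map_zero]
  apply ModularForm.sturm_bound_levelOne
  -- Cuspidality supplies the vanishing of `a₀`, so the order is at least 3, while `k < 36` keeps
  -- the Sturm bound at most 2.
  have hle : ((3 : ℕ) : ℕ∞) ≤ (qExpansion 1 (CuspForm.toModularFormₗ (f - g))).order := by
    refine PowerSeries.nat_le_order _ _ fun i hi => ?_
    change coeffₗ k i (f - g) = 0
    interval_cases i
    · exact coeffₗ_zero _
    · rw [map_sub, h1, sub_self]
    · rw [map_sub, h2, sub_self]
  refine lt_of_lt_of_le ?_ hle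
  exact_mod_cast (by omega : k.toNat / 12 < 3)

/-- Division by `Δ` identifies `S₂₄` with `M₁₂`, to which the level one dimension formula applies.
-/
lemma finrank_cuspForm_twentyFour : Module.finrank ℂ (CuspForm 𝒮ℒ 24) = 2 := by
  rw [CuspForm.discriminantEquiv.finrank_eq]
  apply Module.finrank_eq_of_rank_eq
  have := ModularForm.dimension_level_one 12 ⟨6, rfl⟩
  rw [if_neg (by decide)] at this
  norm_num at this
  exact_mod_cast this

/-- An eigenform of `T_2` of small weight with first coefficient `1` is an eigenform of all `T_n`. -/
lemma heckeOperator_eq_smul {k : ℤ} (hk : k < 36) {f : CuspForm 𝒮ℒ k} (h1 : coeffₗ k 1 f = 1)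
    {c : ℂ} (h2 : heckeOperator k 2 f = c • f) (n : ℕ+) :
    heckeOperator k n f = coeffₗ k n f • f := by
  have hc : coeffₗ k 2 f = c := by
    have := coeffₗ_one_heckeOperator 2 f
    rw [h2, map_smul, h1, smul_eq_mul, mul_one] at this
    exact this.symm
  apply ext_of_coeff hk
  · rw [coeffₗ_one_heckeOperator, map_smul, h1, smul_eq_mul, mul_one]
  -- The symmetry `a₂(T_n f) = a_n(T₂ f)` reduces the second coefficient to the known action of
  -- `T₂`.
  · have := coeffₗ_heckeOperator_comm 2 n f
    rw [h2, map_smul] at this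
    rw [map_smul, hc, smul_eq_mul, mul_comm]
    exact this

/-! ### Two forms of weight 24 and their expansions up to `q⁴`. -/

/-- `Δ²` as a cusp form of weight `24`. -/
noncomputable def discriminantSq : CuspForm 𝒮ℒ 24 :=
  CuspForm.mcast (by norm_num)
    (CuspForm.discriminant.mulModularForm (CuspForm.toModularFormₗ CuspForm.discriminant))

lemma coe_discriminantSq : (discriminantSq : ℍ → ℂ) = ModularForm.discriminant ^ 2 :=
  (sq _).symm

/-- `Δ E₄³` as a cusp form of weight `24`. -/
noncomputable def discriminantMulE₄Cube : CuspForm 𝒮ℒ 24 :=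
  CuspForm.mcast (by norm_num) (CuspForm.discriminant.mulModularForm (E₄.pow 3))

lemma qExpansion_discriminantSq :
    qExpansion 1 discriminantSq = qExpansion 1 ModularForm.discriminant ^ 2 := by
  rw [sq]
  exact ModularForm.qExpansion_mul_coe one_pos one_mem_strictPeriods_SL CuspForm.discriminant
    CuspForm.discriminant

lemma qExpansion_discriminantMulE₄Cube :
    qExpansion 1 discriminantMulE₄Cube =
      qExpansion 1 ModularForm.discriminant * qExpansion 1 E₄ ^ 3 := by
  rw [← ModularForm.qExpansion_pow one_pos one_mem_strictPeriods_SL]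
  exact ModularForm.qExpansion_mul_coe one_pos one_mem_strictPeriods_SL CuspForm.discriminant
    (E₄.pow 3)

/-- This lets the coefficients of `Δ` be computed from those of Eisenstein series instead of the
infinite product. -/
lemma qExpansion_discriminant : (1728 : ℂ) • qExpansion 1 ModularForm.discriminant =
    qExpansion 1 E₄ ^ 3 - qExpansion 1 E₆ ^ 2 := by
  rw [← ModularForm.qExpansion_pow one_pos one_mem_strictPeriods_SL,
    ← ModularForm.qExpansion_pow one_pos one_mem_strictPeriods_SL]
  have h := ModularForm.qExpansion_sub one_pos one_mem_strictPeriods_SL (E₄.pow 3) (E₆.pow 2)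
  have h' := ModularForm.qExpansion_smul one_pos one_mem_strictPeriods_SL (1728 : ℂ)
    CuspForm.discriminant
  rw [CuspForm.coe_discriminant] at h'
  rw [← h, ← h']
  congr 1
  ext τ
  change 1728 * ModularForm.discriminant τ = E₄ τ ^ 3 - E₆ τ ^ 2
  rw [ModularForm.discriminant_eq_E₄_cube_sub_E₆_sq]
  ring

/-- The power series `p` begins with `a + b q + c q² + d q³ + e q⁴`. -/
def StartsWith (p : PowerSeries ℂ) (a b c d e : ℂ) : Prop :=
  p.coeff 0 = a ∧ p.coeff 1 = b ∧ p.coeff 2 = c ∧ p.coeff 3 = d ∧ p.coeff 4 = e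

/-- Cauchy product cut off after `q⁴`, which is as far as needed: `a₂(T₂ f)` involves `a₄`. -/
lemma StartsWith.mul {p p' : PowerSeries ℂ} {a b c d e a' b' c' d' e' : ℂ}
    (h : StartsWith p a b c d e) (h' : StartsWith p' a' b' c' d' e') :
    StartsWith (p * p') (a * a') (a * b' + b * a') (a * c' + b * b' + c * a')
      (a * d' + b * c' + c * b' + d * a') (a * e' + b * d' + c * c' + d * b' + e * a') := by
  obtain ⟨rfl, rfl, rfl, rfl, rfl⟩ := h
  obtain ⟨rfl, rfl, rfl, rfl, rfl⟩ := h'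
  refine ⟨?_, ?_, ?_, ?_, ?_⟩ <;>
    rw [PowerSeries.coeff_mul, Finset.Nat.sum_antidiagonal_eq_sum_range_succ_mk] <;>
    simp [Finset.sum_range_succ]

/-- The coefficients are `240 σ₃(n)`, where `240 = -8 / B₄`. -/
lemma startsWith_E₄ : StartsWith (qExpansion 1 E₄) 1 240 2160 6720 17520 := by
  have hB : _root_.bernoulli 4 = -1 / 30 := by decide +kernel
  have h2 : (2 : ℕ).divisors = {1, 2} := by decide
  have h3 : (3 : ℕ).divisors = {1, 3} := by decide
  have h4 : (4 : ℕ).divisors = {1, 2, 4} := by decide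
  refine ⟨?_, ?_, ?_, ?_, ?_⟩ <;>
    norm_num [E_qExpansion_coeff _ ⟨2, rfl⟩, hB, ArithmeticFunction.sigma_apply, h2, h3, h4]

/-- The coefficients are `-504 σ₅(n)`, where `-504 = -12 / B₆`. -/
lemma startsWith_E₆ :
    StartsWith (qExpansion 1 E₆) 1 (-504) (-16632) (-122976) (-532728) := by
  have hB : _root_.bernoulli 6 = 1 / 42 := by decide +kernel
  have h2 : (2 : ℕ).divisors = {1, 2} := by decide
  have h3 : (3 : ℕ).divisors = {1, 3} := by decide
  have h4 : (4 : ℕ).divisors = {1, 2, 4} := by decide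
  refine ⟨?_, ?_, ?_, ?_, ?_⟩ <;>
    norm_num [E_qExpansion_coeff _ ⟨3, rfl⟩, hB, ArithmeticFunction.sigma_apply, h2, h3, h4]

lemma startsWith_E₄_cube :
    StartsWith (qExpansion 1 E₄ ^ 3) 1 720 179280 16954560 396974160 := by
  have h := (startsWith_E₄.mul startsWith_E₄).mul startsWith_E₄
  rw [pow_succ, sq]
  norm_num at h
  exact h

lemma startsWith_discriminant :
    StartsWith (qExpansion 1 ModularForm.discriminant) 0 1 (-24) 252 (-1472) := by
  have h6 := startsWith_E₆.mul startsWith_E₆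
  rw [← sq] at h6
  norm_num at h6
  obtain ⟨a0, a1, a2, a3, a4⟩ := h6
  obtain ⟨b0, b1, b2, b3, b4⟩ := startsWith_E₄_cube
  have h : ∀ n, 1728 * (qExpansion 1 ModularForm.discriminant).coeff n =
      (qExpansion 1 E₄ ^ 3).coeff n - (qExpansion 1 E₆ ^ 2).coeff n := fun n => by
    rw [← map_sub, ← qExpansion_discriminant, PowerSeries.coeff_smul, smul_eq_mul]
  have h0 := h 0
  have h1 := h 1
  have h2 := h 2
  have h3 := h 3
  have h4 := h 4
  rw [a0, b0] at h0
  rw [a1, b1] at h1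
  rw [a2, b2] at h2
  rw [a3, b3] at h3
  rw [a4, b4] at h4
  refine ⟨?_, ?_, ?_, ?_, ?_⟩
  · linear_combination h0 / 1728
  · linear_combination h1 / 1728
  · linear_combination h2 / 1728
  · linear_combination h3 / 1728
  · linear_combination h4 / 1728

lemma startsWith_discriminantSq : StartsWith (qExpansion 1 discriminantSq) 0 0 1 (-48) 1080 := by
  have h := startsWith_discriminant.mul startsWith_discriminant
  rw [qExpansion_discriminantSq, sq]
  norm_num at h
  exact h

lemma startsWith_discriminantMulE₄Cube :
    StartsWith (qExpansion 1 discriminantMulE₄Cube) 0 1 696 162252 12831808 := by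
  have h := startsWith_discriminant.mul startsWith_E₄_cube
  rw [qExpansion_discriminantMulE₄Cube]
  norm_num at h
  exact h

/-! ### The line `a₁ = 1` and the eigenforms on it. -/

/-- The cusp form of weight `24` with Fourier expansion `q + c q² + ⋯`. -/
noncomputable def formOfCoeff (c : ℂ) : CuspForm 𝒮ℒ 24 :=
  -- The `q²` coefficient of `ΔE₄³` is `720 - 24 = 696`.
  discriminantMulE₄Cube + (c - 696) • discriminantSq

lemma coeffₗ_one_formOfCoeff (c : ℂ) : coeffₗ 24 1 (formOfCoeff c) = 1 := by
  have h1 : coeffₗ 24 1 discriminantMulE₄Cube = 1 := startsWith_discriminantMulE₄Cube.2.1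
  have h2 : coeffₗ 24 1 discriminantSq = 0 := startsWith_discriminantSq.2.1
  rw [formOfCoeff, map_add, map_smul, h1, h2, smul_zero, add_zero]

lemma coeffₗ_two_formOfCoeff (c : ℂ) : coeffₗ 24 2 (formOfCoeff c) = c := by
  have h1 : coeffₗ 24 2 discriminantMulE₄Cube = 696 := startsWith_discriminantMulE₄Cube.2.2.1
  have h2 : coeffₗ 24 2 discriminantSq = 1 := startsWith_discriminantSq.2.2.1
  rw [formOfCoeff, map_add, map_smul, h1, h2, smul_eq_mul]
  ring

lemma coeffₗ_four_formOfCoeff (c : ℂ) :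
    coeffₗ 24 4 (formOfCoeff c) = 12831808 + (c - 696) * 1080 := by
  have h1 : coeffₗ 24 4 discriminantMulE₄Cube = 12831808 :=
    startsWith_discriminantMulE₄Cube.2.2.2.2
  have h2 : coeffₗ 24 4 discriminantSq = 1080 := startsWith_discriminantSq.2.2.2.2
  rw [formOfCoeff, map_add, map_smul, h1, h2, smul_eq_mul]

lemma eq_formOfCoeff {f : CuspForm 𝒮ℒ 24} (h : coeffₗ 24 1 f = 1) :
    f = formOfCoeff (coeffₗ 24 2 f) :=
  ext_of_coeff (by norm_num) (by rw [h, coeffₗ_one_formOfCoeff]) (coeffₗ_two_formOfCoeff _).symm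

/-- The parameter enters only through the `Δ²` term; applied to the two eigenforms, this yields `κ =
c - d`. -/
lemma formOfCoeff_sub (c d : ℂ) :
    formOfCoeff c - formOfCoeff d = (c - d) • discriminantSq := by
  rw [formOfCoeff, formOfCoeff, add_sub_add_left_eq_sub, ← sub_smul, sub_sub_sub_cancel_right]

/-- Both sides always agree in `a₁`, so the only condition is equality of `a₂`, namely `a₄ + 2²³ a₁
= c²`. -/
lemma heckeOperator_two_formOfCoeff_iff (c : ℂ) :
    heckeOperator 24 2 (formOfCoeff c) = c • formOfCoeff c ↔ c ^ 2 = 1080 * c + 20468736 := by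
  have h4 : coeffₗ 24 2 (heckeOperator 24 2 (formOfCoeff c)) = 1080 * c + 20468736 := by
    rw [coeffₗ_two_heckeOperator_two, coeffₗ_one_formOfCoeff, coeffₗ_four_formOfCoeff]
    norm_num
    ring
  constructor
  · intro h
    rw [h, map_smul, coeffₗ_two_formOfCoeff, smul_eq_mul, ← sq] at h4
    exact h4
  · intro h
    apply ext_of_coeff (by norm_num)
    · rw [coeffₗ_one_heckeOperator, map_smul, coeffₗ_one_formOfCoeff, smul_eq_mul, mul_one]
      exact coeffₗ_two_formOfCoeff c
    · rw [h4, map_smul, coeffₗ_two_formOfCoeff, smul_eq_mul, ← sq, h]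

/-- The eigenvalue equation for `T₂` alone already cuts out these forms, and conversely it implies
the one for every `T_n`. -/
lemma isNormalizedEigenform_iff (f : CuspForm 𝒮ℒ 24) :
    IsNormalizedEigenform f ↔ ∃ c : ℂ, c ^ 2 = 1080 * c + 20468736 ∧ f = formOfCoeff c := by
  constructor
  · rintro ⟨hT, h1⟩
    obtain ⟨μ, hμ⟩ := hT 2 Nat.prime_two
    have hf := eq_formOfCoeff h1
    have hc : coeffₗ 24 2 f = μ := by
      have := coeffₗ_one_heckeOperator 2 f
      rw [hμ, map_smul, coeffₗ_apply 1, h1, smul_eq_mul, mul_one] at this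
      exact this.symm
    rw [hc] at hf
    rw [hf] at hμ
    exact ⟨μ, (heckeOperator_two_formOfCoeff_iff μ).mp hμ, hf⟩
  · rintro ⟨c, hc, rfl⟩
    exact ⟨fun p _ => ⟨_, heckeOperator_eq_smul (by norm_num) (coeffₗ_one_formOfCoeff c)
      ((heckeOperator_two_formOfCoeff_iff c).mpr hc) p⟩, coeffₗ_one_formOfCoeff c⟩

/-- The two eigenvalues of `T_2` in weight `24`. -/
lemma exists_eigenvalues : ∃ c d : ℂ, c ≠ d ∧
    ∀ x : ℂ, x ^ 2 = 1080 * x + 20468736 ↔ x = c ∨ x = d := by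
  -- A quarter of the discriminant is `540² + 20468736 = 144 · 144169`, so the roots are `540 ±
  -- 12√144169`.
  obtain ⟨s, hs⟩ := IsAlgClosed.exists_pow_nat_eq (144169 : ℂ) two_pos
  have hs0 : s ≠ 0 := by
    rintro rfl
    norm_num at hs
  refine ⟨540 + 12 * s, 540 - 12 * s, fun h => hs0 (by linear_combination h / 24), fun x => ?_⟩
  rw [← sub_eq_zero, show x ^ 2 - (1080 * x + 20468736) =
    (x - (540 + 12 * s)) * (x - (540 - 12 * s)) by linear_combination 144 * hs, mul_eq_zero,
    sub_eq_zero, sub_eq_zero]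

/-! ### Eigenvalues of `T_n` and the coefficients of `Δ²`. -/

/-- The two eigenforms are a basis in which `T_n` is diagonal, with their `n`-th coefficients as
entries. -/
lemma hasDistinctEigenvalues_iff {c d : ℂ} (hcd : c ≠ d) (hc : c ^ 2 = 1080 * c + 20468736)
    (hd : d ^ 2 = 1080 * d + 20468736) (n : ℕ+) :
    HasDistinctEigenvalues 24 n ↔ coeffₗ 24 n (formOfCoeff c) ≠ coeffₗ 24 n (formOfCoeff d) := by
  have hli : LinearIndependent ℂ ![formOfCoeff c, formOfCoeff d] := by
    rw [LinearIndependent.pair_iff]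
    intro s t h
    have h1 := congrArg (coeffₗ 24 1) h
    have h2 := congrArg (coeffₗ 24 2) h
    simp only [map_add, map_smul, map_zero, coeffₗ_one_formOfCoeff, coeffₗ_two_formOfCoeff,
      smul_eq_mul, mul_one] at h1 h2
    have hs : s = 0 := by
      have : s * (c - d) = 0 := by linear_combination h2 - d * h1
      exact (mul_eq_zero.mp this).resolve_right (sub_ne_zero.mpr hcd)
    exact ⟨hs, by simpa [hs] using h1⟩
  let b := basisOfLinearIndependentOfCardEqFinrank hli
    (by rw [finrank_cuspForm_twentyFour, Fintype.card_fin])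
  have hb : ⇑b = ![formOfCoeff c, formOfCoeff d] :=
    coe_basisOfLinearIndependentOfCardEqFinrank _ _
  let w : Fin 2 → ℂ := ![coeffₗ 24 n (formOfCoeff c), coeffₗ 24 n (formOfCoeff d)]
  have hT : ∀ i, heckeOperator 24 n (b i) = w i • b i := by
    intro i
    rw [hb]
    fin_cases i
    · exact heckeOperator_eq_smul (by norm_num) (coeffₗ_one_formOfCoeff c)
        ((heckeOperator_two_formOfCoeff_iff c).mpr hc) n
    · exact heckeOperator_eq_smul (by norm_num) (coeffₗ_one_formOfCoeff d)
        ((heckeOperator_two_formOfCoeff_iff d).mpr hd) n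
  have hM : LinearMap.toMatrix b b (heckeOperator 24 n) = Matrix.diagonal w := by
    ext i j
    rw [LinearMap.toMatrix_apply, hT, map_smul, b.repr_self, Matrix.diagonal_apply]
    by_cases hij : i = j
    · simp [hij]
    · simp [hij]
  -- Equality of multisets: a coincidence `w 0 = w 1` is recorded as a double root.
  have hroots : (heckeOperator 24 n).charpoly.roots = {w 0, w 1} := by
    rw [← LinearMap.charpoly_toMatrix _ b, hM, Matrix.charpoly_diagonal, Fin.prod_univ_two,
      Polynomial.roots_mul (mul_ne_zero (X_sub_C_ne_zero _) (X_sub_C_ne_zero _)),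
      Polynomial.roots_X_sub_C, Polynomial.roots_X_sub_C]
    rfl
  rw [HasDistinctEigenvalues, hroots]
  simp [w]

/-- The `n`-th coefficient of `F_c - F_d = (c - d)Δ²` is the difference of the eigenvalues of `T_n`,
and `c - d ≠ 0`. -/
lemma fourierCoeff_discriminant_sq_ne_zero_iff (n : ℕ+) :
    fourierCoeff (ModularForm.discriminant ^ 2) n ≠ 0 ↔ HasDistinctEigenvalues 24 n := by
  obtain ⟨c, d, hcd, h⟩ := exists_eigenvalues
  rw [hasDistinctEigenvalues_iff hcd ((h c).mpr (.inl rfl)) ((h d).mpr (.inr rfl)),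
    ← sub_ne_zero (a := coeffₗ 24 n _), ← map_sub, formOfCoeff_sub, map_smul, smul_eq_mul, mul_ne_zero_iff, coeffₗ_apply,
    coe_discriminantSq]
  exact ⟨fun h => ⟨sub_ne_zero.mpr hcd, h⟩, fun h => h.2⟩

/-- An irreducible polynomial over `ℚ` is separable, and separability survives extension to `ℂ`. -/
lemma HasDistinctEigenvalues.of_maedaConjecture {k : ℤ} (h : MaedaConjecture k) {n : ℕ+}
    (hn : 1 < n) : HasDistinctEigenvalues k n := by
  obtain ⟨P, hP, hirr, -⟩ := h n hn
  rw [HasDistinctEigenvalues, ← hP]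
  exact Polynomial.nodup_roots hirr.separable.map

/-- The coefficients of `1` and `q` in `Δ²` vanish; dropping them shifts the index by 2. -/
lemma hasSum_a48 (τ : ℍ) :
    HasSum (fun n : ℕ ↦ a48 n * Function.Periodic.qParam 1 τ ^ (n + 2))
      (ModularForm.discriminant τ ^ 2) := by
  have h := ModularForm.hasSum_qExpansion discriminantSq one_pos one_mem_strictPeriods_SL τ
  rw [← hasSum_nat_add_iff' 2] at h
  have h0 := startsWith_discriminantSq.1
  have h1 := startsWith_discriminantSq.2.1
  rw [Finset.sum_range_succ, Finset.sum_range_one, h0, h1, zero_mul, zero_mul, add_zero,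
    sub_zero] at h
  rw [coe_discriminantSq] at h
  exact h

end Hecke

theorem mainTheorem8 :
    Module.finrank ℂ (CuspForm 𝒮ℒ 24) = 2 ∧
    (∃ f g : CuspForm 𝒮ℒ 24, f ≠ g ∧
      (∀ h : CuspForm 𝒮ℒ 24, Hecke.IsNormalizedEigenform h ↔ h = f ∨ h = g) ∧
      ∃ κ : ℂ, κ ≠ 0 ∧ ∀ τ : ℍ, ModularForm.discriminant τ ^ 2 = (f τ - g τ) / κ) ∧
    (∀ n : ℕ+, Hecke.fourierCoeff (ModularForm.discriminant ^ 2) n ≠ 0 ↔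
      Hecke.HasDistinctEigenvalues 24 n) ∧
    (∀ τ : ℍ, HasSum (fun n : ℕ ↦ Hecke.a48 n * Function.Periodic.qParam 1 τ ^ (n + 2))
      (ModularForm.discriminant τ ^ 2)) ∧
    (Hecke.MaedaConjecture 24 → ∀ n : ℕ, Hecke.a48 n ≠ 0) := by
  obtain ⟨c, d, hcd, h⟩ := Hecke.exists_eigenvalues
  refine ⟨Hecke.finrank_cuspForm_twentyFour,
    ⟨Hecke.formOfCoeff c, Hecke.formOfCoeff d, fun hfg => hcd ?_, fun f => ?_, c - d,
      sub_ne_zero.mpr hcd, fun τ => ?_⟩,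
    Hecke.fourierCoeff_discriminant_sq_ne_zero_iff, Hecke.hasSum_a48, fun hM n => ?_⟩
  · rw [← Hecke.coeffₗ_two_formOfCoeff c, hfg, Hecke.coeffₗ_two_formOfCoeff]
  · rw [Hecke.isNormalizedEigenform_iff]
    simp only [h, or_and_right, exists_or, exists_eq_left]
  · rw [eq_div_iff (sub_ne_zero.mpr hcd), mul_comm]
    refine Eq.trans ?_ (DFunLike.congr_fun (Hecke.formOfCoeff_sub c d) τ).symm
    change _ = (c - d) * (Hecke.discriminantSq : ℍ → ℂ) τ
    rw [Hecke.coe_discriminantSq]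
    rfl
  -- `a₄₈(n)` is the coefficient of index `n + 2`, which exceeds 1 even for `n = 0`, so Maeda's
  -- conjecture covers every `n`.
  · exact (Hecke.fourierCoeff_discriminant_sq_ne_zero_iff (n + 1).succPNat).mpr
      (.of_maedaConjecture hM (by rw [← PNat.coe_lt_coe, Nat.succPNat_coe, PNat.one_coe]; omega))
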